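/- Let $(R,\mathfrak m)$ be a regular local ring of dimension $d\ge 1$ and let $I$ be an $\mathfrak m$-primary ideal of $R$. Take a minimal free resolution $$0\to F_d\xrightarrow{\varphi_d}F_{d-1}\to\cdots\to F_1\xrightarrow{\varphi_1}F_0\to R/I\to 0$$ of the $R$-module $R/I$ by finitely generated free modules, and let $I_1(\varphi_d)$ denote the ideal of $R$ generated by the entries of a matrix representing $\varphi_d$. Consider the following conditions. 1. $I$ is a Burch ideal, that is, $\mathfrak m I\ne\mathfrak m(I:_R\mathfrak m)$. 2. There exist a regular system of parameters $x_1,\dots,x_d$ of $R$ and an integer $r>0$ such that $I_1(\varphi_d)=(x_1^r,x_2,\dots,x_d)$. 3. $(I:_R\mathfrak m)^2\ne I\,(I:_R\mathfrak m)$. Then (1) implies (2). If $R$ contains a field, then (3) implies (2). If $d=2$, then (2) implies (1). -/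

import Mathlib

universe u v w

/-- An ideal `I` of a local ring `(R, 𝔪)` is a *Burch ideal* if `𝔪 I ≠ 𝔪 (I :_R 𝔪)`. -/
def IsBurchIdeal {R : Type*} [CommRing R] [IsLocalRing R] (I : Ideal R) : Prop :=
  IsLocalRing.maximalIdeal R * I ≠
    IsLocalRing.maximalIdeal R * I.colon (IsLocalRing.maximalIdeal R : Set R)

/-- A minimal free resolution `⋯ → F 2 → F 1 → F 0 → M → 0` of a module `M` over a local ring
`(R, 𝔪)`, by finitely generated free modules. The differential `φ i : F (i + 1) → F i` is the map
usually written `φ_{i + 1}`. -/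
structure MinimalFreeResolution (R : Type u) [CommRing R] [IsLocalRing R]
    (M : Type v) [AddCommGroup M] [Module R M] where
  F : ℕ → Type w
  [addCommGroup : ∀ i, AddCommGroup (F i)]
  [module : ∀ i, Module R (F i)]
  [free : ∀ i, Module.Free R (F i)]
  [finite : ∀ i, Module.Finite R (F i)]
  φ : ∀ i, F (i + 1) →ₗ[R] F i
  ε : F 0 →ₗ[R] M
  ε_surjective : Function.Surjective ε
  exact_zero : Function.Exact (φ 0) ε
  exact_succ : ∀ i, Function.Exact (φ (i + 1)) (φ i)
  minimal : ∀ i, LinearMap.range (φ i) ≤ IsLocalRing.maximalIdeal R • (⊤ : Submodule R (F i))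

attribute [instance] MinimalFreeResolution.addCommGroup MinimalFreeResolution.module
  MinimalFreeResolution.free MinimalFreeResolution.finite

open Classical in
/-- `I₁(f)`: the ideal generated by the entries (the `1 × 1` minors) of a matrix of the linear map
`f` between finitely generated free modules. By `idealOfEntries_eq` below it does not depend on the
bases. -/
noncomputable def idealOfEntries {R M N : Type*} [CommRing R]
    [AddCommGroup M] [Module R M] [Module.Free R M] [Module.Finite R M]
    [AddCommGroup N] [Module R N] [Module.Free R N] [Module.Finite R N] (f : M →ₗ[R] N) : Ideal R :=
  Ideal.span {a | ∃ i j, a =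
    LinearMap.toMatrix (Module.Free.chooseBasis R M) (Module.Free.chooseBasis R N) f i j}

/-- The entries of any matrix of `f` generate the ideal of all `l (f x)`, with `l` a linear form. -/
theorem span_entries_eq_span_dual {R M N ι κ : Type*} [CommRing R]
    [AddCommGroup M] [Module R M] [AddCommGroup N] [Module R N]
    [Fintype ι] [DecidableEq ι] [Fintype κ]
    (b : Module.Basis ι R M) (c : Module.Basis κ R N) (f : M →ₗ[R] N) :
    Ideal.span {a | ∃ i j, a = LinearMap.toMatrix b c f i j} =
      Ideal.span {a | ∃ (l : N →ₗ[R] R) (x : M), a = l (f x)} := by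
  apply le_antisymm
  · refine Ideal.span_le.2 ?_
    rintro _ ⟨i, j, rfl⟩
    exact Ideal.subset_span ⟨c.coord i, b j, by simp [LinearMap.toMatrix_apply]⟩
  · refine Ideal.span_le.2 ?_
    rintro _ ⟨l, x, rfl⟩
    rw [← b.sum_repr x]
    simp only [map_sum, map_smul]
    refine Ideal.sum_mem _ fun j _ => ?_
    rw [← c.sum_repr (f (b j))]
    simp only [map_sum, map_smul, smul_eq_mul]
    refine Ideal.mul_mem_left _ _ (Ideal.sum_mem _ fun i _ => ?_)
    exact Ideal.mul_mem_right _ _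
      (Ideal.subset_span ⟨i, j, by simp [LinearMap.toMatrix_apply]⟩)

/-- `I₁(f)` can be computed in any pair of bases. -/
theorem idealOfEntries_eq {R M N ι κ : Type*} [CommRing R]
    [AddCommGroup M] [Module R M] [Module.Free R M] [Module.Finite R M]
    [AddCommGroup N] [Module R N] [Module.Free R N] [Module.Finite R N]
    [Fintype ι] [DecidableEq ι] [Fintype κ]
    (b : Module.Basis ι R M) (c : Module.Basis κ R N) (f : M →ₗ[R] N) :
    idealOfEntries f = Ideal.span {a | ∃ i j, a = LinearMap.toMatrix b c f i j} := by
  classical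
  rw [span_entries_eq_span_dual b c f, idealOfEntries, span_entries_eq_span_dual]

/-- `x₁, …, x_d` is a regular system of parameters of the local ring `R`: it generates the maximal
ideal and `d = dim R`. -/
def IsRegularSystemOfParameters {R : Type*} [CommRing R] [IsLocalRing R] {d : ℕ}
    (x : Fin d → R) : Prop :=
  ringKrullDim R = d ∧ Ideal.span (Set.range x) = IsLocalRing.maximalIdeal R

/-- The ideal `J` is of the form `(x₁ ^ r, x₂, …, x_d)` for a regular system of parameters
`x₁, …, x_d` of `R` and an integer `r > 0`. -/
def IsPowerOfOneParameter {R : Type*} [CommRing R] [IsLocalRing R] (d : ℕ) (J : Ideal R) : Prop :=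
  ∃ x : Fin d → R, IsRegularSystemOfParameters x ∧ ∃ r : ℕ, 0 < r ∧
    J = Ideal.span (Set.range fun i : Fin d => if (i : ℕ) = 0 then x i ^ r else x i)

/-! Write `d = n + 1`, so that `P.φ n` is the last map φ_d, and put J = I₁(φ_d), which lies in 𝔪 by
minimality. An exchange argument gives a regular system of parameters whose first `s` members lie in
J and generate J modulo 𝔪².

If `s ≥ n`, let p be generated by the first `n` parameters. Modulo p the maximal ideal is principal,
so J is p plus a power of the last parameter unless J ≤ p. The latter would kill the socle of R/I,
which is nonzero.

If `s < n`, then n = m + 1 and J lies in m parameters plus 𝔪², so either of the two remaining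
parameters may be put last. The engine is a Koszul computation: for a regular sequence y of length
n, H_n(F/yF) ≅ (0 :_{R/I} y), with boundaries coming from φ_d. When J ≤ (y, z²) for the last
parameter z, every socle element has the form z·b with b killed by y (`exists_smul_eq_of_range_le`).
Doing this for both choices of z forces 𝔪(I : 𝔪) = 𝔪I (`not_isBurchIdeal`) and (I : 𝔪)² = I(I : 𝔪)
(`colon_sq_eq`), against (1) and (3) respectively.

For d = 2, condition (2) puts a parameter in J, so J is not inside 𝔪². A direct chase shows that a
non-Burch ideal has J ≤ 𝔪². -/

/-- The ideal generated by the first `j` terms of the sequence `x`. -/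
def initialIdeal {R : Type*} [CommRing R] (x : ℕ → R) (j : ℕ) : Ideal R :=
  Ideal.span (x '' Set.Iio j)

/-! ### Ideals generated by initial segments of a sequence -/

section InitialIdeal

variable {R : Type*} [CommRing R]

theorem initialIdeal_zero (x : ℕ → R) : initialIdeal x 0 = ⊥ := by
  simp [initialIdeal]

theorem mem_initialIdeal (x : ℕ → R) {i j : ℕ} (h : i < j) : x i ∈ initialIdeal x j :=
  Ideal.subset_span ⟨i, h, rfl⟩

theorem initialIdeal_le_iff (x : ℕ → R) {j : ℕ} {J : Ideal R} :
    initialIdeal x j ≤ J ↔ ∀ i < j, x i ∈ J := by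
  rw [initialIdeal, Ideal.span_le]
  exact ⟨fun h i hi => h ⟨i, hi, rfl⟩, by rintro h _ ⟨i, hi, rfl⟩; exact h i hi⟩

theorem initialIdeal_mono (x : ℕ → R) {i j : ℕ} (h : i ≤ j) :
    initialIdeal x i ≤ initialIdeal x j :=
  (initialIdeal_le_iff x).2 fun _ hk => mem_initialIdeal x (hk.trans_le h)

theorem initialIdeal_succ (x : ℕ → R) (j : ℕ) :
    initialIdeal x (j + 1) = initialIdeal x j ⊔ Ideal.span {x j} := by
  apply le_antisymm
  · refine (initialIdeal_le_iff x).2 fun i hi => ?_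
    rcases (Nat.lt_succ_iff_lt_or_eq.1 hi) with h | rfl
    · exact Ideal.mem_sup_left (mem_initialIdeal x h)
    · exact Ideal.mem_sup_right (Ideal.mem_span_singleton_self _)
  · refine sup_le (initialIdeal_mono x j.le_succ) ?_
    rw [Ideal.span_singleton_le_iff_mem]
    exact mem_initialIdeal x j.lt_succ_self

theorem initialIdeal_congr {x y : ℕ → R} {j : ℕ} (h : ∀ i < j, x i = y i) :
    initialIdeal x j = initialIdeal y j :=
  le_antisymm ((initialIdeal_le_iff x).2 fun i hi => h i hi ▸ mem_initialIdeal y hi)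
    ((initialIdeal_le_iff y).2 fun i hi => h i hi ▸ mem_initialIdeal x hi)

end InitialIdeal

/-! ### Congruences in modules and ideals of entries -/

section Smul

variable {R M : Type*} [CommRing R] [AddCommGroup M] [Module R M]

theorem exists_sub_smul_mem_of_mem_sup_span_smul {p : Ideal R} {y : R} {m : M}
    (h : m ∈ (p ⊔ Ideal.span {y}) • (⊤ : Submodule R M)) :
    ∃ f : M, m - y • f ∈ p • (⊤ : Submodule R M) := by
  rw [Submodule.sup_smul, Submodule.ideal_span_singleton_smul] at h
  obtain ⟨a, ha, b, hb, rfl⟩ := Submodule.mem_sup.1 h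
  obtain ⟨f, -, rfl⟩ := (Submodule.mem_smul_pointwise_iff_exists _ _ _).1 hb
  exact ⟨f, by simpa using ha⟩

theorem LinearMap.map_smul_top_mem {N : Type*} [AddCommGroup N] [Module R N] (f : M →ₗ[R] N)
    (p : Ideal R) {m : M} (h : m ∈ p • (⊤ : Submodule R M)) :
    f m ∈ p • (⊤ : Submodule R N) := by
  have := Submodule.mem_map_of_mem (f := f) h
  rw [Submodule.map_smul''] at this
  exact Submodule.smul_mono le_rfl le_top this

theorem Module.Basis.mem_ideal_smul_top_iff {ι : Type*} (b : Module.Basis ι R M) (p : Ideal R)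
    (m : M) : m ∈ p • (⊤ : Submodule R M) ↔ ∀ i, b.repr m i ∈ p := by
  constructor
  · intro h i
    have := LinearMap.map_smul_top_mem (b.coord i) p h
    simpa using this
  · intro h
    rw [← b.linearCombination_repr m, Finsupp.linearCombination_apply]
    exact Submodule.sum_mem _ fun i _ => Submodule.smul_mem_smul (h i) trivial

theorem Module.Free.mem_smul_top_of_smul_mem [Module.Free R M] {p : Ideal R} {y : R}
    (hy : ∀ r, y * r ∈ p → r ∈ p) {m : M} (h : y • m ∈ p • (⊤ : Submodule R M)) :
    m ∈ p • (⊤ : Submodule R M) := by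
  have b := Module.Free.chooseBasis R M
  rw [b.mem_ideal_smul_top_iff] at h ⊢
  exact fun i => hy _ (by simpa using h i)

/-- The entries of `f` lie in `J` if and only if the image of `f` lies in `J N`. -/
theorem idealOfEntries_le_iff {N : Type*} [AddCommGroup N] [Module R N]
    [Module.Free R M] [Module.Finite R M] [Module.Free R N] [Module.Finite R N]
    (f : M →ₗ[R] N) (J : Ideal R) :
    idealOfEntries f ≤ J ↔ LinearMap.range f ≤ J • (⊤ : Submodule R N) := by
  classical
  let b := Module.Free.chooseBasis R M
  let c := Module.Free.chooseBasis R N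
  rw [idealOfEntries_eq b c f, span_entries_eq_span_dual, Ideal.span_le]
  constructor
  · rintro h _ ⟨m, rfl⟩
    exact (c.mem_ideal_smul_top_iff J _).2 fun i => h ⟨c.coord i, m, rfl⟩
  · rintro h _ ⟨l, m, rfl⟩
    simpa using LinearMap.map_smul_top_mem l J (h ⟨m, rfl⟩)

end Smul

/-! ### Koszul homology of a resolution in its top degree -/

section Koszul

variable {R : Type u} [CommRing R] {M : Type v} [AddCommGroup M] [Module R M]
  {F : ℕ → Type w} [∀ i, AddCommGroup (F i)] [∀ i, Module R (F i)]

/-- For an exact complex `F` of modules on which `y` is a regular sequence, the complex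
`F / (y₁, …, y_j) F` is exact in degrees greater than `j`. -/
theorem mem_range_sup_of_map_mem_initialIdeal_smul (φ : ∀ i, F (i + 1) →ₗ[R] F i)
    (hφ : ∀ i, Function.Exact (φ (i + 1)) (φ i)) (y : ℕ → R) (n : ℕ)
    (hy : ∀ j < n, ∀ i, ∀ f : F i, y j • f ∈ initialIdeal y j • (⊤ : Submodule R (F i)) →
      f ∈ initialIdeal y j • (⊤ : Submodule R (F i)))
    (j : ℕ) (hj : j ≤ n) (i : ℕ) (hi : j ≤ i) (e : F (i + 1))
    (he : φ i e ∈ initialIdeal y j • (⊤ : Submodule R (F i))) :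
    e ∈ LinearMap.range (φ (i + 1)) ⊔ initialIdeal y j • (⊤ : Submodule R (F (i + 1))) := by
  induction j generalizing i with
  | zero =>
    rw [initialIdeal_zero, Submodule.bot_smul, Submodule.mem_bot] at he
    exact Submodule.mem_sup_left ((hφ i e).1 he)
  | succ j ih =>
    obtain ⟨k, rfl⟩ : ∃ k, i = k + 1 := ⟨i - 1, by omega⟩
    have he' := he
    rw [initialIdeal_succ] at he'
    obtain ⟨f, hf⟩ := exists_sub_smul_mem_of_mem_sup_span_smul he'
    -- Here φ(e) ≡ y_j f modulo the first j terms. Since φ² = 0, regularity cancels y_j and makes f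
    -- a cycle, hence a boundary φ(g); then e - y_j g is a cycle modulo the first j terms.
    have h1 : φ k f ∈ initialIdeal y j • (⊤ : Submodule R (F k)) := by
      apply hy j (by omega)
      have := LinearMap.map_smul_top_mem (φ k) _ hf
      rw [map_sub, (hφ k).apply_apply_eq_zero, zero_sub, map_smul] at this
      exact neg_mem_iff.1 this
    obtain ⟨_, ⟨g, rfl⟩, q, hq, rfl⟩ := Submodule.mem_sup.1 (ih (by omega) k (by omega) f h1)
    have h2 : φ (k + 1) (e - y j • g) ∈ initialIdeal y j • (⊤ : Submodule R (F (k + 1))) := by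
      have : φ (k + 1) (e - y j • g) =
          (φ (k + 1) e - y j • (φ (k + 1) g + q)) + y j • q := by
        rw [map_sub, map_smul]; module
      rw [this]
      exact add_mem hf (Submodule.smul_mem _ _ hq)
    have h3 := ih (by omega) (k + 1) (by omega) _ h2
    have hle := sup_le_sup_left (Submodule.smul_mono_left (N := (⊤ : Submodule R (F (k + 1 + 1))))
      (initialIdeal_mono y j.le_succ)) (LinearMap.range (φ (k + 1 + 1)))
    rw [← sub_add_cancel e (y j • g)]
    refine add_mem (hle h3)
      (Submodule.mem_sup_right (Submodule.smul_mem_smul (mem_initialIdeal y j.lt_succ_self) trivial))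

/-- The elements of `F j` that are cycles modulo `(y₁, …, y_j)`. -/
def cyclesMod (φ : ∀ i, F (i + 1) →ₗ[R] F i) (y : ℕ → R) : ∀ j, Submodule R (F j)
  | 0 => ⊤
  | j + 1 => (initialIdeal y (j + 1) • (⊤ : Submodule R (F j))).comap (φ j)

theorem mem_cyclesMod_of_mem (φ : ∀ i, F (i + 1) →ₗ[R] F i) (y : ℕ → R) (j : ℕ) {f : F j}
    (hf : f ∈ initialIdeal y j • (⊤ : Submodule R (F j))) : f ∈ cyclesMod φ y j := by
  cases j with
  | zero => trivial
  | succ j => exact LinearMap.map_smul_top_mem (φ j) _ hf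

theorem mem_cyclesMod_of_smul_mem (φ : ∀ i, F (i + 1) →ₗ[R] F i) (y : ℕ → R) (j : ℕ) (r : R)
    (hr : ∀ i, ∀ f : F i, r • f ∈ initialIdeal y j • (⊤ : Submodule R (F i)) →
      f ∈ initialIdeal y j • (⊤ : Submodule R (F i)))
    {f : F j} (hf : r • f ∈ cyclesMod φ y j) : f ∈ cyclesMod φ y j := by
  cases j with
  | zero => trivial
  | succ j =>
    apply hr
    rw [← map_smul]
    exact hf

/-- The homology of `F / (y₁, …, y_j) F` in degree `j`, for a resolution `F` of `M` on which `y` is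
a regular sequence, is the submodule of `M` of all elements killed by `y₁, …, y_j`. The isomorphism
is given by its graph `Γ`. -/
theorem exists_graph_cyclesMod (φ : ∀ i, F (i + 1) →ₗ[R] F i) (ε : F 0 →ₗ[R] M)
    (hε : Function.Surjective ε) (hφ₀ : Function.Exact (φ 0) ε)
    (hφ : ∀ i, Function.Exact (φ (i + 1)) (φ i)) (y : ℕ → R) (n : ℕ)
    (hy : ∀ j < n, ∀ i, ∀ f : F i, y j • f ∈ initialIdeal y j • (⊤ : Submodule R (F i)) →
      f ∈ initialIdeal y j • (⊤ : Submodule R (F i)))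
    (j : ℕ) (hj : j ≤ n) :
    ∃ Γ : Submodule R (F j × M),
      (∀ f a, (f, a) ∈ Γ → ∀ i < j, y i • a = 0) ∧
      (∀ f ∈ cyclesMod φ y j, ∃ a, (f, a) ∈ Γ) ∧
      (∀ a, (∀ i < j, y i • a = 0) → ∃ f, f ∈ cyclesMod φ y j ∧ (f, a) ∈ Γ) ∧
      (∀ f, (f, 0) ∈ Γ →
        f ∈ LinearMap.range (φ j) ⊔ initialIdeal y j • (⊤ : Submodule R (F j))) ∧
      (∀ f a, (f, a) ∈ Γ →
        f ∈ LinearMap.range (φ j) ⊔ initialIdeal y j • (⊤ : Submodule R (F j)) → a = 0) := by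
  induction j with
  | zero =>
    refine ⟨LinearMap.graph ε, by simp, fun f _ => ⟨ε f, by simp⟩, fun a _ => ?_, ?_, ?_⟩
    · obtain ⟨f, rfl⟩ := hε a
      exact ⟨f, trivial, by simp⟩
    · intro f hf
      exact Submodule.mem_sup_left ((hφ₀ f).1 (by simpa using hf.symm))
    · intro f a hf hB
      rw [initialIdeal_zero, Submodule.bot_smul, sup_bot_eq] at hB
      have h1 : ε f = 0 := (hφ₀ f).2 hB
      have h2 : a = ε f := by simpa using hf
      rw [h2, h1]
  | succ j ih =>
    obtain ⟨Γ, h1, h2, h3, h4, h5⟩ := ih (by omega)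
    -- This is the connecting map for multiplication by y_j on F/(y_0, …, y_{j-1})F: a cycle e goes
    -- to the class of f with φ(e) ≡ y_j f. A relation avoids choosing f. As H_{j+1} of that
    -- quotient vanishes, the map identifies the new homology with the kernel of y_j on the old one.
    let Γ' : Submodule R (F (j + 1) × M) :=
      { carrier := {z | ∃ f, (f, z.2) ∈ Γ ∧
          φ j z.1 - y j • f ∈ initialIdeal y j • (⊤ : Submodule R (F j))}
        zero_mem' := ⟨0, Γ.zero_mem, by simp⟩
        add_mem' := by
          rintro z z' ⟨f, hf, hz⟩ ⟨f', hf', hz'⟩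
          refine ⟨f + f', Γ.add_mem hf hf', ?_⟩
          have := add_mem hz hz'
          rw [Prod.fst_add, map_add, smul_add]
          convert this using 1
          abel
        smul_mem' := by
          rintro r z ⟨f, hf, hz⟩
          refine ⟨r • f, Γ.smul_mem r hf, ?_⟩
          have := Submodule.smul_mem _ r hz
          rw [Prod.smul_fst, map_smul, smul_comm, ← smul_sub]
          exact this }
    have hΓ' : ∀ e a, (e, a) ∈ Γ' ↔ ∃ f, (f, a) ∈ Γ ∧
          φ j e - y j • f ∈ initialIdeal y j • (⊤ : Submodule R (F j)) := fun _ _ => Iff.rfl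
    have hle : initialIdeal y j • (⊤ : Submodule R (F j)) ≤
        initialIdeal y (j + 1) • (⊤ : Submodule R (F j)) :=
      Submodule.smul_mono_left (initialIdeal_mono y j.le_succ)
    have hZ : ∀ e f, φ j e - y j • f ∈ initialIdeal y j • (⊤ : Submodule R (F j)) →
        e ∈ cyclesMod φ y (j + 1) := by
      intro e f hef
      change φ j e ∈ initialIdeal y (j + 1) • (⊤ : Submodule R (F j))
      rw [← sub_add_cancel (φ j e) (y j • f)]
      exact add_mem (hle hef)
        (Submodule.smul_mem_smul (mem_initialIdeal y j.lt_succ_self) trivial)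
    refine ⟨Γ', ?_, ?_, ?_, ?_, ?_⟩
    · intro e a hea i hi
      obtain ⟨f, hf, hef⟩ := (hΓ' e a).1 hea
      rcases (Nat.lt_succ_iff_lt_or_eq.1 hi) with h | rfl
      · exact h1 f a hf i h
      · refine h5 (y i • f) _ (Γ.smul_mem _ hf) ?_
        have : y i • f = φ i e - (φ i e - y i • f) := by abel
        rw [this]
        exact sub_mem (Submodule.mem_sup_left ⟨e, rfl⟩) (Submodule.mem_sup_right hef)
    · intro e he
      change φ j e ∈ initialIdeal y (j + 1) • (⊤ : Submodule R (F j)) at he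
      rw [initialIdeal_succ] at he
      obtain ⟨f, hf⟩ := exists_sub_smul_mem_of_mem_sup_span_smul he
      have : f ∈ cyclesMod φ y j := by
        cases j with
        | zero => trivial
        | succ k =>
          apply hy (k + 1) (by omega)
          have := LinearMap.map_smul_top_mem (φ k) _ hf
          rw [map_sub, (hφ k).apply_apply_eq_zero, zero_sub, map_smul] at this
          exact neg_mem_iff.1 this
      obtain ⟨a, ha⟩ := h2 f this
      exact ⟨a, (hΓ' e a).2 ⟨f, ha, hf⟩⟩
    · intro a ha
      obtain ⟨f, -, hf⟩ := h3 a fun i hi => ha i (by omega)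
      have hz : (y j • f, (0 : M)) ∈ Γ := by
        have := Γ.smul_mem (y j) hf
        rwa [Prod.smul_mk, ha j (by omega)] at this
      obtain ⟨_, ⟨e, rfl⟩, q, hq, hqe⟩ := Submodule.mem_sup.1 (h4 _ hz)
      have hef : φ j e - y j • f ∈ initialIdeal y j • (⊤ : Submodule R (F j)) := by
        rw [← hqe, sub_add_cancel_left]
        exact neg_mem hq
      exact ⟨e, hZ e f hef, (hΓ' e a).2 ⟨f, hf, hef⟩⟩
    · intro e he
      obtain ⟨f, hf, hef⟩ := (hΓ' e 0).1 he
      obtain ⟨_, ⟨g, rfl⟩, q, hq, rfl⟩ := Submodule.mem_sup.1 (h4 f hf)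
      have h6 : φ j (e - y j • g) ∈ initialIdeal y j • (⊤ : Submodule R (F j)) := by
        have : φ j (e - y j • g) = (φ j e - y j • (φ j g + q)) + y j • q := by
          rw [map_sub, map_smul]; module
        rw [this]
        exact add_mem hef (Submodule.smul_mem _ _ hq)
      have h7 := mem_range_sup_of_map_mem_initialIdeal_smul φ hφ y n hy j (by omega) j le_rfl _ h6
      rw [← sub_add_cancel e (y j • g)]
      have hle' := sup_le_sup_left (Submodule.smul_mono_left (N := (⊤ : Submodule R (F (j + 1))))
        (initialIdeal_mono y j.le_succ)) (LinearMap.range (φ (j + 1)))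
      exact add_mem (hle' h7)
        (Submodule.mem_sup_right
          (Submodule.smul_mem_smul (mem_initialIdeal y j.lt_succ_self) trivial))
    · intro e a hea he
      obtain ⟨f, hf, hef⟩ := (hΓ' e a).1 hea
      obtain ⟨_, ⟨g, rfl⟩, q, hq, rfl⟩ := Submodule.mem_sup.1 he
      rw [initialIdeal_succ] at hq
      obtain ⟨h, hh⟩ := exists_sub_smul_mem_of_mem_sup_span_smul hq
      have h6 : y j • (f - φ j h) ∈ initialIdeal y j • (⊤ : Submodule R (F j)) := by
        have h7 := sub_mem (LinearMap.map_smul_top_mem (φ j) _ hh) hef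
        rw [map_add, (hφ j).apply_apply_eq_zero, zero_add, map_sub, map_smul] at h7
        convert h7 using 1
        module
      refine h5 f a hf ?_
      rw [← sub_add_cancel f (φ j h)]
      exact add_mem (Submodule.mem_sup_right (hy j (by omega) _ _ h6))
        (Submodule.mem_sup_left ⟨h, rfl⟩)

variable (φ : ∀ i, F (i + 1) →ₗ[R] F i) (ε : F 0 →ₗ[R] M)
    (hε : Function.Surjective ε) (hφ₀ : Function.Exact (φ 0) ε)
    (hφ : ∀ i, Function.Exact (φ (i + 1)) (φ i)) (y : ℕ → R) (n : ℕ)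
    (hy : ∀ j < n + 1, ∀ i, ∀ f : F i, y j • f ∈ initialIdeal y j • (⊤ : Submodule R (F i)) →
      f ∈ initialIdeal y j • (⊤ : Submodule R (F i)))

include hε hφ₀ hφ hy

/-- If the entries of `φ n` lie in `(y₁, …, y_n, y_{n+1} ^ 2)`, then the elements of `M` killed by
`y₁, …, y_{n+1}` are multiples by `y_{n+1}` of elements killed by `y₁, …, y_n`. -/
theorem exists_smul_eq_of_range_le
    (hr : LinearMap.range (φ n) ≤
      (initialIdeal y n ⊔ Ideal.span {y n ^ 2}) • (⊤ : Submodule R (F n)))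
    (a : M) (ha : ∀ i < n + 1, y i • a = 0) :
    ∃ b : M, y n • b = a ∧ ∀ i < n, y i • b = 0 := by
  obtain ⟨Γ, h1, h2, h3, h4, h5⟩ := exists_graph_cyclesMod φ ε hε hφ₀ hφ y n
    (fun j hj => hy j (by omega)) n le_rfl
  obtain ⟨f, hfZ, hf⟩ := h3 a fun i hi => ha i (by omega)
  have hz : (y n • f, (0 : M)) ∈ Γ := by
    have := Γ.smul_mem (y n) hf
    rwa [Prod.smul_mk, ha n (by omega)] at this
  obtain ⟨_, ⟨e, rfl⟩, q, hq, hqe⟩ := Submodule.mem_sup.1 (h4 _ hz)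
  obtain ⟨f', hf'⟩ := exists_sub_smul_mem_of_mem_sup_span_smul (hr ⟨e, rfl⟩)
  -- The class of f is a, and y_n f is a boundary because y_n a = 0. Boundaries are ≡ y_n² f', so
  -- cancelling y_n gives f ≡ y_n f'; the class of f' is the required b.
  have h6 : f - y n • f' ∈ initialIdeal y n • (⊤ : Submodule R (F n)) := by
    apply hy n (by omega)
    have : y n • (f - y n • f') = (φ n e - y n ^ 2 • f') + q := by
      rw [smul_sub, ← hqe]; module
    rw [this]
    exact add_mem hf' hq
  have h7 : f' ∈ cyclesMod φ y n := by
    refine mem_cyclesMod_of_smul_mem φ y n (y n) (hy n (by omega)) ?_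
    rw [← sub_sub_cancel f (y n • f')]
    exact sub_mem hfZ (mem_cyclesMod_of_mem φ y n h6)
  obtain ⟨b, hb⟩ := h2 f' h7
  refine ⟨b, ?_, h1 f' b hb⟩
  have h8 := h5 _ _ (sub_mem hf (Γ.smul_mem (y n) hb)) (Submodule.mem_sup_right h6)
  exact (sub_eq_zero.1 h8).symm

/-- If the entries of `φ n` lie in `(y₁, …, y_n)`, then no nonzero element of `M` is killed by
`y₁, …, y_{n+1}`. -/
theorem eq_zero_of_range_le
    (hr : LinearMap.range (φ n) ≤ initialIdeal y n • (⊤ : Submodule R (F n)))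
    (a : M) (ha : ∀ i < n + 1, y i • a = 0) : a = 0 := by
  obtain ⟨Γ, h1, h2, h3, h4, h5⟩ := exists_graph_cyclesMod φ ε hε hφ₀ hφ y n
    (fun j hj => hy j (by omega)) n le_rfl
  obtain ⟨f, -, hf⟩ := h3 a fun i hi => ha i (by omega)
  have hz : (y n • f, (0 : M)) ∈ Γ := by
    have := Γ.smul_mem (y n) hf
    rwa [Prod.smul_mk, ha n (by omega)] at this
  have h6 := h4 _ hz
  rw [sup_eq_right.2 hr] at h6
  exact h5 f a hf (Submodule.mem_sup_right (hy n (by omega) _ _ h6))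

end Koszul

open IsLocalRing

/-! ### Regular systems of parameters -/

section RegularLocalRing

variable {R : Type u} [CommRing R]

/-- A local Noetherian ring whose maximal ideal is minimally generated by `n` elements has, for each
proper ideal `J`, a minimal system of generators `x` of the maximal ideal that starts with elements
of `J` which generate `J` modulo the square of the maximal ideal. -/
theorem exists_initialIdeal_eq_maximalIdeal_of_le [IsLocalRing R] {J : Ideal R}
    (hJ : J ≤ maximalIdeal R) (n k s : ℕ) (hs : s + k = n) (x : ℕ → R)
    (hx : initialIdeal x n = maximalIdeal R) (hxs : ∀ i < s, x i ∈ J) :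
    ∃ (s : ℕ) (x : ℕ → R), s ≤ n ∧ initialIdeal x n = maximalIdeal R ∧ (∀ i < s, x i ∈ J) ∧
      J ≤ initialIdeal x s ⊔ maximalIdeal R ^ 2 := by
  induction k generalizing s x with
  | zero =>
    obtain rfl : s = n := by omega
    exact ⟨s, x, le_rfl, hx, hxs, by rw [hx]; exact hJ.trans le_sup_left⟩
  | succ k ih =>
    by_cases hle : J ≤ initialIdeal x s ⊔ maximalIdeal R ^ 2
    · exact ⟨s, x, by omega, hx, hxs, hle⟩
    obtain ⟨y, hyJ, hy⟩ := Set.not_subset.1 hle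
    have hxm : ∀ i < n, x i ∈ maximalIdeal R := fun i hi => hx ▸ mem_initialIdeal x hi
    have hym := hJ hyJ
    rw [← hx, initialIdeal, ← Finset.coe_range, Ideal.span,
      Submodule.mem_span_image_finset_iff_exists_fun'] at hym
    obtain ⟨c, hc⟩ := hym
    obtain ⟨i, hin, his, hu⟩ : ∃ i < n, s ≤ i ∧ IsUnit (c i) := by
      by_contra! hcon
      refine hy ?_
      rw [← hc]
      refine Ideal.sum_mem _ fun i hi => ?_
      rcases lt_or_ge i s with h | h
      · exact Ideal.mul_mem_left _ _ (Ideal.mem_sup_left (mem_initialIdeal x h))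
      · have hin := Finset.mem_range.1 hi
        rw [pow_two]
        exact Ideal.mem_sup_right (Ideal.mul_mem_mul
          ((mem_maximalIdeal _).2 (hcon i hin h)) (hxm i hin))
    -- Steinitz exchange: the generator x_i with unit coefficient is discarded, y takes position s,
    -- and the old x_s moves to position i.
    let x' : ℕ → R := Function.update (x ∘ Equiv.swap s i) s y
    have hx's : x' s = y := Function.update_self ..
    have hx'i : i ≠ s → x' i = x s := fun h => by
      simp [x', Function.update_of_ne h]
    have hx'o : ∀ l, l ≠ s → l ≠ i → x' l = x l := fun l h h' => by
      simp [x', Function.update_of_ne h, Equiv.swap_apply_of_ne_of_ne h h']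
    have hother : ∀ l < n, l ≠ i → x l ∈ initialIdeal x' n := by
      intro l hl hli
      by_cases hls : l = s
      · subst hls
        rw [← hx'i hli.symm]
        exact mem_initialIdeal x' hin
      · rw [← hx'o l hls hli]
        exact mem_initialIdeal x' hl
    refine ih (s + 1) (by omega) x' (le_antisymm ?_ ?_) ?_
    · refine (initialIdeal_le_iff x').2 fun l hl => ?_
      by_cases hls : l = s
      · rw [hls, hx's]
        exact hJ hyJ
      by_cases hli : l = i
      · subst hli
        rw [hx'i hls]
        exact hxm s (by omega)
      · rw [hx'o l hls hli]
        exact hxm l hl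
    · rw [← hx]
      refine (initialIdeal_le_iff x).2 fun l hl => ?_
      by_cases hli : l = i
      · subst hli
        rw [← Finset.add_sum_erase _ _ (Finset.mem_range.2 hl)] at hc
        rw [← (initialIdeal x' n).unit_mul_mem_iff_mem hu]
        have : c l * x l = y - ∑ j ∈ (Finset.range n).erase l, c j • x j := by
          rw [← hc, smul_eq_mul]; ring
        rw [this]
        refine sub_mem (hx's ▸ mem_initialIdeal x' (by omega)) (Ideal.sum_mem _ fun j hj => ?_)
        exact Ideal.mul_mem_left _ _ (hother j (Finset.mem_range.1 (Finset.mem_of_mem_erase hj))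
          (Finset.ne_of_mem_erase hj))
      · exact hother l hl hli
    · intro l hl
      rcases Nat.lt_succ_iff_lt_or_eq.1 hl with h | rfl
      · rw [hx'o l (by omega) (by omega)]
        exact hxs l h
      · rw [hx's]
        exact hyJ

/-- A minimal system of generators of the maximal ideal of a regular local ring, starting with
elements of a given proper ideal `J` which generate `J` modulo the square of the maximal ideal. -/
theorem exists_initialIdeal_eq_maximalIdeal [IsRegularLocalRing R] {d : ℕ}
    (hd : ringKrullDim R = d) {J : Ideal R} (hJ : J ≤ maximalIdeal R) :
    ∃ (s : ℕ) (x : ℕ → R), s ≤ d ∧ initialIdeal x d = maximalIdeal R ∧ (∀ i < s, x i ∈ J) ∧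
      J ≤ initialIdeal x s ⊔ maximalIdeal R ^ 2 := by
  have hsr : (maximalIdeal R).spanFinrank = d := by
    have := IsRegularLocalRing.spanFinrank_maximalIdeal (R := R)
    rw [hd] at this
    exact_mod_cast this
  have fg := (maximalIdeal R).fg_of_isNoetherianRing
  have hfin := Submodule.FG.finite_generators fg
  have hcard : hfin.toFinset.card = d := by
    rw [← Set.ncard_eq_toFinset_card _ hfin, Submodule.FG.generators_ncard fg, hsr]
  let e := hfin.toFinset.equivFinOfCardEq hcard
  let x : ℕ → R := fun i => if h : i < d then (e.symm ⟨i, h⟩ : R) else 0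
  refine exists_initialIdeal_eq_maximalIdeal_of_le hJ d d 0 (by omega) x ?_ (by simp)
  rw [← (maximalIdeal R).span_generators, initialIdeal, Ideal.span]
  congr 1
  ext r
  constructor
  · rintro ⟨i, hi, rfl⟩
    have hi' : i < d := hi
    have := (e.symm ⟨i, hi'⟩).2
    simp only [x, dif_pos hi']
    exact hfin.mem_toFinset.1 this
  · intro hr
    refine ⟨e ⟨r, hfin.mem_toFinset.2 hr⟩, (e ⟨r, hfin.mem_toFinset.2 hr⟩).2, ?_⟩
    simp [x]

/-- The quotient of a regular local ring by part of a regular system of parameters. -/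
theorem isRegularLocalRing_quotient_span [IsRegularLocalRing R] {d : ℕ} (hd : ringKrullDim R = d)
    {A B : Set R} (hA : A.Finite) (hB : B.Finite) (hAB : Ideal.span (A ∪ B) = maximalIdeal R)
    (hcard : A.ncard + B.ncard ≤ d) :
    IsRegularLocalRing (R ⧸ Ideal.span A) ∧ ringKrullDim (R ⧸ Ideal.span A) = B.ncard := by
  have hAm : Ideal.span A ≤ maximalIdeal R := by
    rw [← hAB]
    exact Ideal.span_mono Set.subset_union_left
  have hne : Ideal.span A ≠ ⊤ := fun h => (maximalIdeal.isMaximal R).ne_top (top_le_iff.1 (h ▸ hAm))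
  have : Nontrivial (R ⧸ Ideal.span A) := Ideal.Quotient.nontrivial_iff.2 hne
  have hloc : IsLocalRing (R ⧸ Ideal.span A) :=
    IsLocalRing.of_surjective' (Ideal.Quotient.mk _) Ideal.Quotient.mk_surjective
  have hmax : maximalIdeal (R ⧸ Ideal.span A) =
      Ideal.span (Ideal.Quotient.mk (Ideal.span A) '' B) := by
    rw [← map_maximalIdeal_of_surjective (Ideal.Quotient.mk (Ideal.span A))
      Ideal.Quotient.mk_surjective, ← hAB, Ideal.span_union, Ideal.map_sup, Ideal.map_quotient_self,
      bot_sup_eq, Ideal.map_span]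
  have h1 : (maximalIdeal (R ⧸ Ideal.span A)).spanFinrank ≤ B.ncard := by
    rw [hmax]
    exact (Submodule.spanFinrank_span_le_ncard_of_finite (hB.image _)).trans
      (Set.ncard_image_le hB)
  have h2 := ringKrullDim_le_ringKrullDim_quotient_add_spanFinrank (I := Ideal.span A)
    (by rwa [IsLocalRing.ringJacobson_eq_maximalIdeal])
  have h3 : (Ideal.span A).spanFinrank ≤ A.ncard :=
    Submodule.spanFinrank_span_le_ncard_of_finite hA
  have h4 := ringKrullDim_le_spanFinrank_maximalIdeal (R ⧸ Ideal.span A)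
  -- The dimension of the quotient is at least d - |A| ≥ |B| and at most its number of generators,
  -- hence at most |B|.
  rw [hd] at h2
  suffices ringKrullDim (R ⧸ Ideal.span A) = B.ncard from
    ⟨IsRegularLocalRing.of_spanFinrank_maximalIdeal_le _ (by rw [this]; exact_mod_cast h1), this⟩
  generalize ringKrullDim (R ⧸ Ideal.span A) = t at h2 h4
  induction t with
  | bot => simp at h2
  | coe t =>
    induction t with
    | top => exact absurd h4 (not_le.2 (WithBot.coe_lt_coe.2 (ENat.natCast_lt_top _)))
    | coe t =>
      norm_cast at h2 h4 ⊢
      omega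

/-- Induction on dimension. Prime avoidance yields x in 𝔪, outside 𝔪² and all minimal primes. The
quotient by x is regular of smaller dimension, so (x) is prime and contains a minimal prime q. As x
∉ q, q = xq, and Nakayama gives q = 0. -/
theorem isDomain_of_isRegularLocalRing_of_ringKrullDim_eq (d : ℕ) (R : Type u) [CommRing R]
    [IsRegularLocalRing R] (hd : ringKrullDim R = d) : IsDomain R := by
  induction d generalizing R with
  | zero =>
    have hsr : (maximalIdeal R).spanFinrank = 0 := by
      have := IsRegularLocalRing.spanFinrank_maximalIdeal (R := R)
      rw [hd] at this
      exact_mod_cast this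
    have : maximalIdeal R = ⊥ :=
      (Submodule.spanFinrank_eq_zero_iff_eq_bot (maximalIdeal R).fg_of_isNoetherianRing).1 hsr
    exact (isField_iff_maximalIdeal_eq.2 this).isDomain
  | succ d ih =>
    have hmin : ∀ p ∈ minimalPrimes R, ¬ maximalIdeal R ≤ p := by
      intro p hp hle
      have hpm : maximalIdeal R = p := (maximalIdeal.isMaximal R).eq_of_le hp.1.1.ne_top hle
      have : (maximalIdeal R).height = 0 := by
        have hprime := hp.1.1
        rw [hpm]
        exact Ideal.height_eq_zero_iff.2 hp
      have h := maximalIdeal_height_eq_ringKrullDim (R := R)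
      rw [this, hd] at h
      have h' : ((0 : ℕ) : WithBot ℕ∞) = ((d + 1 : ℕ) : WithBot ℕ∞) := by exact_mod_cast h
      exact absurd (by exact_mod_cast h' : (0 : ℕ) = d + 1) (by omega)
    have hsq : ¬ maximalIdeal R ≤ maximalIdeal R ^ 2 := by
      intro h
      have hbot : maximalIdeal R = ⊥ := by
        apply Submodule.eq_bot_of_le_smul_of_le_jacobson_bot (maximalIdeal R) _
          (maximalIdeal R).fg_of_isNoetherianRing
        · rwa [smul_eq_mul, ← pow_two]
        · exact (IsLocalRing.jacobson_eq_maximalIdeal ⊥ bot_ne_top).ge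
      obtain ⟨p, hp, -⟩ := Ideal.exists_minimalPrimes_le (J := maximalIdeal R) (I := ⊥) bot_le
      exact hmin p hp (hbot ▸ bot_le)
    obtain ⟨x, hxm, hx⟩ : ∃ x ∈ maximalIdeal R, x ∉ maximalIdeal R ^ 2 ∧
        ∀ p ∈ minimalPrimes R, x ∉ p := by
      by_contra! hcon
      have hfin := minimalPrimes.finite_of_isNoetherianRing R
      -- This form of prime avoidance allows two ideals that need not be prime; 𝔪² fills both
      -- places.
      have := (Ideal.subset_union_prime' (s := hfin.toFinset) (f := id)
        (a := maximalIdeal R ^ 2) (b := maximalIdeal R ^ 2)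
        (fun i hi => (hfin.mem_toFinset.1 hi).1.1) (I := maximalIdeal R)).1 (by
          intro x hx
          by_cases h : x ∈ maximalIdeal R ^ 2
          · exact Or.inl (Or.inl h)
          · obtain ⟨p, hp, hxp⟩ := hcon x hx h
            exact Or.inr (Set.mem_biUnion (hfin.mem_toFinset.2 hp) hxp))
      rcases this with h | h | ⟨p, hp, h⟩
      · exact hsq h
      · exact hsq h
      · exact hmin p (hfin.mem_toFinset.1 hp) h
    -- Since x ∉ 𝔪², at least one parameter, `y 0`, is a multiple of x, so x can replace it.
    obtain ⟨s, y, hs, hy, hyJ, hJ⟩ := exists_initialIdeal_eq_maximalIdeal hd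
      (J := Ideal.span {x}) ((Ideal.span_singleton_le_iff_mem _).2 hxm)
    have hs0 : 0 < s := by
      by_contra h
      obtain rfl : s = 0 := by omega
      rw [initialIdeal_zero, bot_sup_eq, Ideal.span_singleton_le_iff_mem] at hJ
      exact hx.1 hJ
    have hgen : Ideal.span ({x} ∪ y '' Set.Ico 1 (d + 1)) = maximalIdeal R := by
      apply le_antisymm
      · rw [Ideal.span_le]
        rintro _ (rfl | ⟨i, hi, rfl⟩)
        · exact hxm
        · exact hy ▸ mem_initialIdeal y hi.2
      · rw [← hy]
        refine (initialIdeal_le_iff y).2 fun i hi => ?_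
        rcases Nat.eq_zero_or_pos i with rfl | h
        · rw [Ideal.span_union]
          exact Ideal.mem_sup_left (hyJ 0 hs0)
        · exact Ideal.subset_span (Or.inr ⟨i, ⟨h, hi⟩, rfl⟩)
    have hcard : (y '' Set.Ico 1 (d + 1)).ncard ≤ d :=
      (Set.ncard_image_le (Set.finite_Ico _ _)).trans (by simp [Set.ncard_eq_toFinset_card'])
    obtain ⟨h1, h2⟩ := isRegularLocalRing_quotient_span hd (Set.finite_singleton x)
      ((Set.finite_Ico 1 (d + 1)).image y) hgen (by rw [Set.ncard_singleton]; omega)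
    have h3 : (y '' Set.Ico 1 (d + 1)).ncard = d := by
      have h4 := ringKrullDim_le_ringKrullDim_quotient_add_spanFinrank (I := Ideal.span {x})
        (by rwa [IsLocalRing.ringJacobson_eq_maximalIdeal, Ideal.span_singleton_le_iff_mem])
      have h5 : (Ideal.span {x}).spanFinrank ≤ ({x} : Set R).ncard :=
        Submodule.spanFinrank_span_le_ncard_of_finite (Set.finite_singleton x)
      rw [hd, h2] at h4
      rw [Set.ncard_singleton] at h5
      norm_cast at h4
      omega
    rw [h3] at h2
    have h4 := ih (R ⧸ Ideal.span {x}) h2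
    have hprime : (Ideal.span {x}).IsPrime := (Ideal.Quotient.isDomain_iff_prime _).1 h4
    obtain ⟨q, hq, hqx⟩ := Ideal.exists_minimalPrimes_le (J := Ideal.span {x}) (I := ⊥) bot_le
    have hqp : q.IsPrime := hq.1.1
    have hq0 : q = ⊥ := by
      apply Submodule.eq_bot_of_le_smul_of_le_jacobson_bot (Ideal.span {x}) _
        q.fg_of_isNoetherianRing
      · intro z hz
        obtain ⟨w, rfl⟩ := Ideal.mem_span_singleton.1 (hqx hz)
        exact Submodule.smul_mem_smul (Ideal.mem_span_singleton_self x)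
          ((hqp.mem_or_mem hz).resolve_left (hx.2 q hq))
      · rw [Ideal.span_singleton_le_iff_mem]
        exact (IsLocalRing.jacobson_eq_maximalIdeal ⊥ bot_ne_top).ge hxm
    rw [hq0] at hqp
    exact IsDomain.of_bot_isPrime R

/-- A regular system of parameters generates a chain of prime ideals. -/
theorem isPrime_initialIdeal [IsRegularLocalRing R] {d : ℕ} (hd : ringKrullDim R = d) {x : ℕ → R}
    (hx : initialIdeal x d = maximalIdeal R) {j : ℕ} (hj : j ≤ d) :
    (initialIdeal x j).IsPrime := by
  have hun : Set.Iio j ∪ Set.Ico j d = Set.Iio d := by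
    ext i; simp; omega
  have h1 : (x '' Set.Iio j).ncard ≤ j :=
    (Set.ncard_image_le (Set.finite_Iio _)).trans (by simp [Set.ncard_eq_toFinset_card'])
  have h2 : (x '' Set.Ico j d).ncard ≤ d - j :=
    (Set.ncard_image_le (Set.finite_Ico _ _)).trans (by simp [Set.ncard_eq_toFinset_card'])
  obtain ⟨h3, h4⟩ := isRegularLocalRing_quotient_span hd ((Set.finite_Iio j).image x)
    ((Set.finite_Ico j d).image x) (by rw [← Set.image_union, hun]; exact hx) (by omega)
  have := isDomain_of_isRegularLocalRing_of_ringKrullDim_eq _ _ h4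
  exact (Ideal.Quotient.isDomain_iff_prime _).1 this

/-- Otherwise x_j would be redundant and d - 1 elements would generate 𝔪. -/
theorem notMem_initialIdeal [IsRegularLocalRing R] {d : ℕ} (hd : ringKrullDim R = d) {x : ℕ → R}
    (hx : initialIdeal x d = maximalIdeal R) {j : ℕ} (hj : j < d) :
    x j ∉ initialIdeal x j := by
  intro h
  have hgen : maximalIdeal R = Ideal.span (x '' (Set.Iio d \ {j})) := by
    rw [← hx]
    apply le_antisymm
    · refine (initialIdeal_le_iff x).2 fun i hi => ?_
      by_cases hij : i = j
      · subst hij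
        refine (initialIdeal_le_iff (J := Ideal.span (x '' (Set.Iio d \ {i}))) x).2
          (fun l hl => ?_) h
        exact Ideal.subset_span ⟨l, ⟨hl.trans hj, hl.ne⟩, rfl⟩
      · exact Ideal.subset_span ⟨i, ⟨hi, hij⟩, rfl⟩
    · exact Ideal.span_mono (Set.image_mono Set.sdiff_subset)
  have hfin : (Set.Iio d \ {j}).Finite := (Set.finite_Iio d).sdiff
  have h1 := IsRegularLocalRing.spanFinrank_maximalIdeal (R := R)
  have h2 : (maximalIdeal R).spanFinrank ≤ (x '' (Set.Iio d \ {j})).ncard := by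
    rw [hgen]
    exact Submodule.spanFinrank_span_le_ncard_of_finite (hfin.image x)
  have h3 : (x '' (Set.Iio d \ {j})).ncard ≤ d - 1 := by
    refine (Set.ncard_image_le hfin).trans ?_
    rw [Set.ncard_sdiff_singleton_of_mem (Set.mem_Iio.2 hj)]
    simp [Set.ncard_eq_toFinset_card']
  rw [hd] at h1
  norm_cast at h1
  omega

/-- A regular system of parameters is a regular sequence on every free module. -/
theorem mem_initialIdeal_smul_top_of_smul_mem [IsRegularLocalRing R] {d : ℕ}
    (hd : ringKrullDim R = d) {x : ℕ → R} (hx : initialIdeal x d = maximalIdeal R) {j : ℕ}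
    (hj : j < d) {M : Type*} [AddCommGroup M] [Module R M] [Module.Free R M] (m : M)
    (hm : x j • m ∈ initialIdeal x j • (⊤ : Submodule R M)) :
    m ∈ initialIdeal x j • (⊤ : Submodule R M) :=
  Module.Free.mem_smul_top_of_smul_mem (fun _ hr =>
    ((isPrime_initialIdeal hd hx hj.le).mem_or_mem hr).resolve_left (notMem_initialIdeal hd hx hj))
    hm

/-- If the maximal ideal of a Noetherian local ring is `(p, z)`, then every ideal strictly between
`p` and the whole ring is of the form `(p, z ^ r)` with `r > 0`. -/
theorem exists_eq_sup_span_pow [IsLocalRing R] [IsNoetherianRing R] {p J : Ideal R} {z : R}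
    (hm : p ⊔ Ideal.span {z} = maximalIdeal R) (hpJ : p ≤ J) (hJm : J ≤ maximalIdeal R)
    (hJp : ¬ J ≤ p) : ∃ r : ℕ, 0 < r ∧ J = p ⊔ Ideal.span {z ^ r} := by
  classical
  obtain ⟨w, hwJ, hwp⟩ := Set.not_subset.1 hJp
  -- Krull's intersection theorem in R/p: w is nonzero there, so it is not divisible by every power
  -- of z.
  have hex : ∃ n, ¬ J ≤ p ⊔ Ideal.span {z ^ n} := by
    by_contra! hcon
    refine hwp (Ideal.Quotient.eq_zero_iff_mem.1 ?_)
    refine IsHausdorff.haus (inferInstance : IsHausdorff (maximalIdeal R) (R ⧸ p)) _ fun n => ?_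
    rw [SModEq.zero]
    obtain ⟨a, ha, b, hb, hab⟩ := Submodule.mem_sup.1 (hcon n hwJ)
    obtain ⟨t, rfl⟩ := Ideal.mem_span_singleton.1 hb
    have hz : z ∈ maximalIdeal R := hm ▸ Ideal.mem_sup_right (Ideal.mem_span_singleton_self z)
    have : Ideal.Quotient.mk p w = z ^ n • Ideal.Quotient.mk p t := by
      rw [← hab, map_add, Ideal.Quotient.eq_zero_iff_mem.2 ha, zero_add]
      rfl
    rw [this]
    exact Submodule.smul_mem_smul (Ideal.pow_mem_pow hz n) trivial
  obtain ⟨r, hr⟩ : ∃ r, Nat.find hex = r + 1 := Nat.exists_eq_succ_of_ne_zero fun h => by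
    have := Nat.find_spec hex
    rw [h] at this
    simp at this
  have hmin : ∀ n ≤ r, J ≤ p ⊔ Ideal.span {z ^ n} := fun n hn =>
    not_not.1 (Nat.find_min hex (by omega))
  have hspec : ¬ J ≤ p ⊔ Ideal.span {z ^ (r + 1)} := hr ▸ Nat.find_spec hex
  refine ⟨r, Nat.pos_of_ne_zero ?_, le_antisymm (hmin r le_rfl) (sup_le hpJ ?_)⟩
  · rintro rfl
    rw [zero_add, pow_one, hm] at hspec
    exact hspec hJm
  · obtain ⟨v, hvJ, hv⟩ := Set.not_subset.1 hspec
    obtain ⟨a, ha, b, hb, rfl⟩ := Submodule.mem_sup.1 (hmin r le_rfl hvJ)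
    obtain ⟨t, rfl⟩ := Ideal.mem_span_singleton.1 hb
    -- With r the last exponent for which J ≤ (p, z^r), a nonunit t would lie in (p, z) and put v in
    -- (p, z^(r+1)).
    have hu : IsUnit t := by
      by_contra ht
      have htm : t ∈ maximalIdeal R := (mem_maximalIdeal _).2 ht
      rw [← hm] at htm
      obtain ⟨a', ha', b', hb', rfl⟩ := Submodule.mem_sup.1 htm
      obtain ⟨t', rfl⟩ := Ideal.mem_span_singleton.1 hb'
      refine hv ?_
      have : a + z ^ r * (a' + z * t') = (a + z ^ r * a') + z ^ (r + 1) * t' := by ring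
      rw [this]
      exact add_mem (Ideal.mem_sup_left (add_mem ha (Ideal.mul_mem_left _ _ ha')))
        (Ideal.mem_sup_right (Ideal.mul_mem_right _ _ (Ideal.mem_span_singleton_self _)))
    rw [Ideal.span_singleton_le_iff_mem, ← J.mul_unit_mem_iff_mem hu]
    exact (J.add_mem_iff_right (hpJ ha)).1 hvJ

end RegularLocalRing

/-! ### Socle elements and the last map of the resolution -/

section Main

variable {R : Type u} [CommRing R]

/-- An `𝔪`-primary ideal has a nonzero socle. -/
theorem exists_notMem_forall_mul_mem_of_radical_eq [IsLocalRing R] [IsNoetherianRing R]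
    {I : Ideal R} (hI : I ≠ ⊤) (hrad : I.radical = maximalIdeal R) :
    ∃ a ∉ I, ∀ y ∈ maximalIdeal R, a * y ∈ I := by
  classical
  have hex : ∃ n, maximalIdeal R ^ n ≤ I :=
    hrad ▸ I.exists_radical_pow_le_of_fg I.radical.fg_of_isNoetherianRing
  obtain ⟨n, hn⟩ : ∃ n, Nat.find hex = n + 1 := Nat.exists_eq_succ_of_ne_zero fun h => by
    have := Nat.find_spec hex
    rw [h, pow_zero, Ideal.one_eq_top] at this
    exact hI (top_le_iff.1 this)
  -- The exponent n + 1 is the least with 𝔪^(n+1) ≤ I, so an element of 𝔪^n outside I is a socle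
  -- element.
  obtain ⟨a, ha, haI⟩ := Set.not_subset.1 (Nat.find_min hex (m := n) (by omega))
  refine ⟨a, haI, fun y hy => ?_⟩
  have := Nat.find_spec hex
  rw [hn, pow_succ] at this
  exact this (Ideal.mul_mem_mul ha hy)

theorem sup_sq_le_initialIdeal_sup_span_sq (x : ℕ → R) (n : ℕ) :
    initialIdeal x (n + 1) ^ 2 ≤ initialIdeal x n ⊔ Ideal.span {x n ^ 2} := by
  rw [initialIdeal_succ]
  generalize initialIdeal x n = p
  rw [pow_two, Ideal.sup_mul]
  refine sup_le (le_sup_of_le_left Ideal.mul_le_left) ?_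
  rw [Ideal.mul_sup, Ideal.span_singleton_mul_span_singleton, ← pow_two]
  exact sup_le_sup_right Ideal.mul_le_right _

theorem isPowerOfOneParameter_of_initialIdeal [IsLocalRing R] {n : ℕ}
    (hd : ringKrullDim R = (n + 1 : ℕ)) {x : ℕ → R}
    (hx : initialIdeal x (n + 1) = maximalIdeal R) {r : ℕ} (hr : 0 < r) :
    IsPowerOfOneParameter (n + 1) (initialIdeal x n ⊔ Ideal.span {x n ^ r}) := by
  -- The order is reversed because `IsPowerOfOneParameter` raises the first parameter to a power,
  -- while here it is the last.
  refine ⟨fun i => x (n - i), ⟨hd, ?_⟩, r, hr, ?_⟩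
  · rw [← hx, initialIdeal]
    congr 1
    ext z
    constructor
    · rintro ⟨i, rfl⟩
      exact ⟨n - i, Set.mem_Iio.2 (by omega), rfl⟩
    · rintro ⟨i, hi, rfl⟩
      have hi' : i < n + 1 := hi
      exact ⟨⟨n - i, by omega⟩, by simp only; congr 1; omega⟩
  · rw [initialIdeal, ← Ideal.span_union]
    congr 1
    ext z
    constructor
    · rintro (⟨i, hi, rfl⟩ | rfl)
      · have hi' : i < n := hi
        refine ⟨⟨n - i, by omega⟩, ?_⟩
        have h0 : n - i ≠ 0 := by omega
        simp only [h0, if_false]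
        congr 1
        omega
      · exact ⟨0, by simp⟩
    · rintro ⟨i, rfl⟩
      by_cases hi : (i : ℕ) = 0
      · right
        simp [hi]
      · left
        exact ⟨n - i, Set.mem_Iio.2 (by omega), by simp [hi]⟩

variable [IsRegularLocalRing R] {I : Ideal R} (P : MinimalFreeResolution.{u, u, v} R (R ⧸ I))

/-- Modulo the first n parameters, 𝔪² is generated by the square of the last one, so the Koszul
divisibility result applies to the socle of R/I. -/
theorem MinimalFreeResolution.exists_mul_sub_mem_of_idealOfEntries_le {n : ℕ}
    (hd : ringKrullDim R = (n + 1 : ℕ)) {x : ℕ → R}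
    (hx : initialIdeal x (n + 1) = maximalIdeal R)
    (hJ : idealOfEntries (P.φ n) ≤ initialIdeal x n ⊔ maximalIdeal R ^ 2)
    {a : R} (ha : ∀ y ∈ maximalIdeal R, a * y ∈ I) :
    ∃ b, a - b * x n ∈ I ∧ ∀ i < n, b * x i ∈ I := by
  have hJ' : idealOfEntries (P.φ n) ≤ initialIdeal x n ⊔ Ideal.span {x n ^ 2} := by
    refine hJ.trans (sup_le le_sup_left ?_)
    rw [← hx]
    exact sup_sq_le_initialIdeal_sup_span_sq x n
  obtain ⟨b, hb, hb'⟩ := exists_smul_eq_of_range_le P.φ P.ε P.ε_surjective P.exact_zero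
    P.exact_succ x n (fun j hj i f hf => mem_initialIdeal_smul_top_of_smul_mem hd hx hj f hf)
    ((idealOfEntries_le_iff _ _).1 hJ') (Ideal.Quotient.mk I a) (fun i hi => by
      change Ideal.Quotient.mk I (x i * a) = 0
      rw [Ideal.Quotient.eq_zero_iff_mem, mul_comm]
      exact ha _ (hx ▸ mem_initialIdeal x hi))
  obtain ⟨b, rfl⟩ := Ideal.Quotient.mk_surjective b
  refine ⟨b, ?_, fun i hi => ?_⟩
  · rw [← Ideal.Quotient.eq, ← hb, mul_comm]
    rfl
  · rw [← Ideal.Quotient.eq_zero_iff_mem, ← hb' i hi, mul_comm]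
    rfl

theorem MinimalFreeResolution.not_idealOfEntries_le {n : ℕ}
    (hd : ringKrullDim R = (n + 1 : ℕ)) {x : ℕ → R}
    (hx : initialIdeal x (n + 1) = maximalIdeal R) (hI : I ≠ ⊤)
    (hrad : I.radical = maximalIdeal R) :
    ¬ idealOfEntries (P.φ n) ≤ initialIdeal x n := by
  intro hJ
  obtain ⟨a, haI, ha⟩ := exists_notMem_forall_mul_mem_of_radical_eq hI hrad
  refine haI (Ideal.Quotient.eq_zero_iff_mem.1 ?_)
  refine eq_zero_of_range_le P.φ P.ε P.ε_surjective P.exact_zero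
    P.exact_succ x n (fun j hj i f hf => mem_initialIdeal_smul_top_of_smul_mem hd hx hj f hf)
    ((idealOfEntries_le_iff _ _).1 hJ) _ (fun i hi => ?_)
  change Ideal.Quotient.mk I (x i * a) = 0
  rw [Ideal.Quotient.eq_zero_iff_mem, mul_comm]
  exact ha _ (hx ▸ mem_initialIdeal x hi)

/-- Either `I₁(φ_d)` is `(x₁ ^ r, x₂, …, x_d)`, or it lies in
`(x₁, …, x_{d-2}) + 𝔪 ^ 2`, for a regular system of parameters `x₁, …, x_d`. -/
theorem MinimalFreeResolution.isPowerOfOneParameter_or_idealOfEntries_le {n : ℕ}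
    (hd : ringKrullDim R = (n + 1 : ℕ)) (hI : I ≠ ⊤) (hrad : I.radical = maximalIdeal R) :
    IsPowerOfOneParameter (n + 1) (idealOfEntries (P.φ n)) ∨
      ∃ m, n = m + 1 ∧ ∃ x : ℕ → R, initialIdeal x (n + 1) = maximalIdeal R ∧
        idealOfEntries (P.φ n) ≤ initialIdeal x m ⊔ maximalIdeal R ^ 2 := by
  have hJm : idealOfEntries (P.φ n) ≤ maximalIdeal R :=
    (idealOfEntries_le_iff _ _).2 (P.minimal n)
  obtain ⟨s, x, hs, hx, hxJ, hJ⟩ := exists_initialIdeal_eq_maximalIdeal hd hJm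
  rcases lt_or_ge s n with hsn | hns
  · obtain ⟨m, rfl⟩ : ∃ m, n = m + 1 := ⟨n - 1, by omega⟩
    exact Or.inr ⟨m, rfl, x, hx,
      hJ.trans (sup_le_sup_right (initialIdeal_mono x (by omega)) _)⟩
  · left
    obtain ⟨r, hr, h⟩ := exists_eq_sup_span_pow (p := initialIdeal x n) (z := x n)
      (J := idealOfEntries (P.φ n)) (by rw [← initialIdeal_succ, hx])
      ((initialIdeal_le_iff x).2 fun i hi => hxJ i (by omega)) hJm
      (P.not_idealOfEntries_le hd hx hI hrad)
    rw [h]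
    exact isPowerOfOneParameter_of_initialIdeal hd hx hr

/-- If `I₁(φ_d)` lies in `(x₁, …, x_{d-2}) + 𝔪 ^ 2`, then each socle element is divisible by
`x_d` and by `x_{d-1}`, by elements killed by all the other parameters. -/
theorem MinimalFreeResolution.exists_mul_sub_mem_and_exists_mul_sub_mem {m : ℕ}
    (hd : ringKrullDim R = (m + 1 + 1 : ℕ)) {x : ℕ → R}
    (hx : initialIdeal x (m + 1 + 1) = maximalIdeal R)
    (hJ : idealOfEntries (P.φ (m + 1)) ≤ initialIdeal x m ⊔ maximalIdeal R ^ 2)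
    {a : R} (ha : ∀ y ∈ maximalIdeal R, a * y ∈ I) :
    (∃ b, a - b * x (m + 1) ∈ I ∧ ∀ i < m + 1, b * x i ∈ I) ∧
      ∃ c, a - c * x m ∈ I ∧ ∀ i < m + 2, i ≠ m → c * x i ∈ I := by
  refine ⟨P.exists_mul_sub_mem_of_idealOfEntries_le hd hx
    (hJ.trans (sup_le_sup_right (initialIdeal_mono x m.le_succ) _)) ha, ?_⟩
  -- The bound on J involves only the first m parameters, so exchanging the last two preserves it.
  let x' : ℕ → R := x ∘ Equiv.swap m (m + 1)
  have h1 : x' m = x (m + 1) := by simp [x']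
  have h2 : x' (m + 1) = x m := by simp [x']
  have h3 : ∀ i < m, x' i = x i := fun i hi => by
    simp [x', Equiv.swap_apply_of_ne_of_ne (show i ≠ m by omega) (show i ≠ m + 1 by omega)]
  have hx' : initialIdeal x' (m + 1 + 1) = maximalIdeal R := by
    rw [← hx]
    simp only [initialIdeal_succ, h1, h2, initialIdeal_congr h3, sup_assoc]
    rw [sup_comm (Ideal.span {x (m + 1)})]
  obtain ⟨c, hc, hc'⟩ := P.exists_mul_sub_mem_of_idealOfEntries_le hd hx'
    (hJ.trans (sup_le_sup_right ((initialIdeal_congr h3).ge.trans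
      (initialIdeal_mono x' m.le_succ)) _)) ha
  rw [h2] at hc
  refine ⟨c, hc, fun i hi him => ?_⟩
  rcases lt_or_ge i m with h | h
  · rw [← h3 i h]
    exact hc' i (by omega)
  · obtain rfl : i = m + 1 := by omega
    rw [← h1]
    exact hc' m (by omega)

theorem mem_colon_maximalIdeal_iff {a : R} :
    a ∈ I.colon (maximalIdeal R : Set R) ↔ ∀ y ∈ maximalIdeal R, a * y ∈ I :=
  Submodule.mem_colon

theorem le_colon_maximalIdeal : I ≤ I.colon (maximalIdeal R : Set R) :=
  fun _ ha => mem_colon_maximalIdeal_iff.2 fun _ _ => Ideal.mul_mem_right _ _ ha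

/-- If a ≡ b·w modulo I and b·e ∈ I, then e·a = e(a - bw) + w(be) lies in 𝔪I. The divisor w =
x_{m+1} handles every parameter e except itself, and w = x_m handles that one. -/
theorem MinimalFreeResolution.not_isBurchIdeal {m : ℕ}
    (hd : ringKrullDim R = (m + 1 + 1 : ℕ)) {x : ℕ → R}
    (hx : initialIdeal x (m + 1 + 1) = maximalIdeal R)
    (hJ : idealOfEntries (P.φ (m + 1)) ≤ initialIdeal x m ⊔ maximalIdeal R ^ 2) :
    ¬ IsBurchIdeal I := by
  rw [IsBurchIdeal, not_not]
  refine le_antisymm (Ideal.mul_mono_right le_colon_maximalIdeal) ?_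
  rw [mul_comm, Ideal.mul_le]
  intro a ha y hy
  have hxm : ∀ i < m + 2, x i ∈ maximalIdeal R := fun i hi => hx ▸ mem_initialIdeal x hi
  obtain ⟨⟨b, hb, hb'⟩, c, hc, hc'⟩ := P.exists_mul_sub_mem_and_exists_mul_sub_mem hd hx hJ
    (mem_colon_maximalIdeal_iff.1 ha)
  have key : ∀ z e w : R, a - z * w ∈ I → z * e ∈ I → e ∈ maximalIdeal R →
      w ∈ maximalIdeal R → e * a ∈ maximalIdeal R * I := by
    intro z e w h1 h2 he hw
    have : e * a = e * (a - z * w) + w * (z * e) := by ring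
    rw [this]
    exact add_mem (Ideal.mul_mem_mul he h1) (Ideal.mul_mem_mul hw h2)
  have hle : maximalIdeal R ≤ (maximalIdeal R * I).colon {a} := by
    rw [← hx, initialIdeal_le_iff, hx]
    intro i hi
    rw [Submodule.mem_colon_singleton, smul_eq_mul]
    rcases Nat.lt_succ_iff_lt_or_eq.1 hi with h | rfl
    · exact key b (x i) _ hb (hb' i h) (hxm i hi) (hxm _ (by omega))
    · exact key c _ _ hc (hc' _ hi (by omega)) (hxm _ hi) (hxm m (by omega))
  have := Submodule.mem_colon_singleton.1 (hle hy)
  rwa [mul_comm a y]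

/-- Modulo I(I : 𝔪), two socle elements a ≡ b·x_{m+1} and a' ≡ c·x_m have product
(b·x_m)(c·x_{m+1}), whose factors both lie in I. -/
theorem MinimalFreeResolution.colon_sq_eq {m : ℕ}
    (hd : ringKrullDim R = (m + 1 + 1 : ℕ)) {x : ℕ → R}
    (hx : initialIdeal x (m + 1 + 1) = maximalIdeal R)
    (hJ : idealOfEntries (P.φ (m + 1)) ≤ initialIdeal x m ⊔ maximalIdeal R ^ 2) :
    I.colon (maximalIdeal R : Set R) ^ 2 = I * I.colon (maximalIdeal R : Set R) := by
  rw [pow_two]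
  refine le_antisymm ?_ (Ideal.mul_mono_left le_colon_maximalIdeal)
  rw [Ideal.mul_le]
  intro a ha a' ha'
  obtain ⟨⟨b, hb, hb'⟩, -⟩ := P.exists_mul_sub_mem_and_exists_mul_sub_mem hd hx hJ
    (mem_colon_maximalIdeal_iff.1 ha)
  obtain ⟨-, c, hc, hc'⟩ := P.exists_mul_sub_mem_and_exists_mul_sub_mem hd hx hJ
    (mem_colon_maximalIdeal_iff.1 ha')
  have h1 : b * x (m + 1) ∈ I.colon (maximalIdeal R : Set R) := by
    rw [← sub_sub_cancel a (b * x (m + 1))]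
    exact sub_mem ha (le_colon_maximalIdeal hb)
  have : a * a' = (a - b * x (m + 1)) * a' + (a' - c * x m) * (b * x (m + 1)) +
      (b * x m) * (c * x (m + 1)) := by ring
  rw [this]
  exact add_mem (add_mem (Ideal.mul_mem_mul hb ha') (Ideal.mul_mem_mul hc h1))
    (Ideal.mul_mem_mul (hb' m (by omega)) (le_colon_maximalIdeal (hc' (m + 1) (by omega)
      (by omega))))

end Main

/-! ### The converse in dimension two -/

section DimensionTwo

variable {R : Type u} [CommRing R] [IsRegularLocalRing R]

theorem exists_not_le_sq_of_isPowerOfOneParameter_two {J : Ideal R}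
    (hJ : IsPowerOfOneParameter 2 J) :
    ∃ x : ℕ → R, initialIdeal x 2 = maximalIdeal R ∧ ¬ J ≤ maximalIdeal R ^ 2 := by
  obtain ⟨z, ⟨hd, hz⟩, r, hr, rfl⟩ := hJ
  let x : ℕ → R := fun i => if i = 0 then z 0 else z 1
  have hx : initialIdeal x 2 = maximalIdeal R := by
    rw [← hz]
    apply le_antisymm
    · refine (initialIdeal_le_iff x).2 fun i hi => Ideal.subset_span ?_
      by_cases h : i = 0
      · exact ⟨0, by simp [x, h]⟩
      · exact ⟨1, by simp [x, h]⟩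
    · rw [Ideal.span_le]
      rintro _ ⟨i, rfl⟩
      fin_cases i
      · exact mem_initialIdeal x (i := 0) (by omega)
      · exact mem_initialIdeal x (i := 1) (by omega)
  refine ⟨x, hx, fun hle => notMem_initialIdeal hd hx (j := 1) (by omega) ?_⟩
  have h1 : x 1 ∈ maximalIdeal R ^ 2 := hle (Ideal.subset_span ⟨1, by simp [x]⟩)
  -- If the unpowered parameter were in 𝔪², Nakayama would make 𝔪 principal.
  have h2 : maximalIdeal R ≤ initialIdeal x 1 := by
    apply Submodule.le_of_le_smul_of_le_jacobson_bot (I := maximalIdeal R)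
      (maximalIdeal R).fg_of_isNoetherianRing
    · exact (IsLocalRing.jacobson_eq_maximalIdeal ⊥ bot_ne_top).ge
    · conv_lhs => rw [← hx, initialIdeal_succ]
      refine sup_le_sup_left ?_ _
      rwa [smul_eq_mul, ← pow_two, Ideal.span_singleton_le_iff_mem]
  exact h2 (hx ▸ mem_initialIdeal x (by omega))

variable {I : Ideal R} (P : MinimalFreeResolution.{u, u, v} R (R ⧸ I))

/-- In dimension two, if `I` is not Burch, then the entries of `φ₂` lie in `𝔪 ^ 2`. -/
theorem MinimalFreeResolution.idealOfEntries_le_sq_of_not_isBurchIdeal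
    (hd : ringKrullDim R = (2 : ℕ)) {x : ℕ → R} (hx : initialIdeal x 2 = maximalIdeal R)
    (hI : ¬ IsBurchIdeal I) : idealOfEntries (P.φ 1) ≤ maximalIdeal R ^ 2 := by
  rw [IsBurchIdeal, not_not] at hI
  rw [idealOfEntries_le_iff]
  rintro _ ⟨e, rfl⟩
  have h0 : x 0 ∈ maximalIdeal R := hx ▸ mem_initialIdeal x (by omega)
  have h1 : x 1 ∈ maximalIdeal R := hx ▸ mem_initialIdeal x (by omega)
  have hsplit : ∀ {m : P.F 0}, m ∈ initialIdeal x 1 • (⊤ : Submodule R (P.F 0)) →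
      ∃ a, m = x 0 • a := by
    intro m hm
    rw [initialIdeal_succ] at hm
    obtain ⟨a, ha⟩ := exists_sub_smul_mem_of_mem_sup_span_smul hm
    rw [initialIdeal_zero, Submodule.bot_smul, Submodule.mem_bot, sub_eq_zero] at ha
    exact ⟨a, ha⟩
  obtain ⟨f, g, hfg⟩ : ∃ f g, P.φ 1 e = x 0 • f + x 1 • g := by
    have h := P.minimal 1 ⟨e, rfl⟩
    rw [← hx, initialIdeal_succ] at h
    obtain ⟨g, hg⟩ := exists_sub_smul_mem_of_mem_sup_span_smul h
    rw [initialIdeal_succ] at hg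
    obtain ⟨f, hf⟩ := exists_sub_smul_mem_of_mem_sup_span_smul hg
    rw [initialIdeal_zero, Submodule.bot_smul, Submodule.mem_bot, sub_sub, sub_eq_zero] at hf
    exact ⟨f, g, by rw [hf, add_comm]⟩
  have hz : x 0 • P.φ 0 f + x 1 • P.φ 0 g = 0 := by
    rw [← map_smul, ← map_smul, ← map_add, ← hfg, (P.exact_succ 0).apply_apply_eq_zero]
  -- The relation x_0 φ(f) + x_1 φ(g) = 0 in a free module is a Koszul relation, so φ(g) = x_0 a'
  -- and φ(f) = -x_1 a'. Both vanish under ε, so ε(a') is a socle element.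
  obtain ⟨a', hg⟩ := hsplit (mem_initialIdeal_smul_top_of_smul_mem hd hx (j := 1) (by omega)
    (P.φ 0 g) (by
      rw [eq_neg_of_add_eq_zero_right hz]
      exact neg_mem (Submodule.smul_mem_smul (mem_initialIdeal x (by omega)) trivial)))
  have hf : P.φ 0 f = -(x 1 • a') := by
    have := mem_initialIdeal_smul_top_of_smul_mem hd hx (j := 0) (by omega)
      (P.φ 0 f + x 1 • a') (by
        rw [smul_add, smul_comm, ← hg, hz]
        exact zero_mem _)
    rw [initialIdeal_zero, Submodule.bot_smul, Submodule.mem_bot] at this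
    exact eq_neg_of_add_eq_zero_left this
  obtain ⟨a, ha⟩ := Ideal.Quotient.mk_surjective (P.ε a')
  have hkill : ∀ i < 2, x i • P.ε a' = 0 := by
    intro i hi
    rw [← map_smul]
    obtain rfl | rfl : i = 0 ∨ i = 1 := by omega
    · rw [← hg, P.exact_zero.apply_apply_eq_zero]
    · rw [← neg_neg (x 1 • a'), ← hf, map_neg, P.exact_zero.apply_apply_eq_zero, neg_zero]
  have haQ : a ∈ I.colon (maximalIdeal R : Set R) := by
    rw [mem_colon_maximalIdeal_iff]
    have : maximalIdeal R ≤ I.colon {a} := by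
      rw [← hx, initialIdeal_le_iff]
      intro i hi
      rw [Submodule.mem_colon_singleton, ← Ideal.Quotient.eq_zero_iff_mem, ← hkill i hi, ← ha]
      rfl
    intro y hy
    have := Submodule.mem_colon_singleton.1 (this hy)
    rwa [mul_comm]
  obtain ⟨w, hw⟩ := P.ε_surjective 1
  have hεw : ∀ r : R, P.ε (r • w) = Ideal.Quotient.mk I r := fun r => by
    rw [map_smul, hw, Algebra.smul_def, mul_one]; rfl
  have hIw : ∀ z ∈ maximalIdeal R * I,
      z • w ∈ maximalIdeal R • LinearMap.range (P.φ 0) := by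
    intro z hz
    refine Submodule.mul_induction_on hz (fun m hm n hn => ?_) fun z z' h h' => ?_
    · rw [mul_smul]
      refine Submodule.smul_mem_smul hm ((P.exact_zero _).1 ?_)
      rw [hεw, Ideal.Quotient.eq_zero_iff_mem.2 hn]
    · rw [add_smul]
      exact add_mem h h'
  -- The failure of Burch enters here: y·a ∈ 𝔪(I : 𝔪) = 𝔪I, and a·w differs from a' by an element of
  -- ker ε = im φ_1.
  have hsm : ∀ y ∈ maximalIdeal R, y • a' ∈ maximalIdeal R • LinearMap.range (P.φ 0) := by
    intro y hy
    have h2 : y • a' = (y * a) • w - y • (a • w - a') := by module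
    rw [h2]
    refine sub_mem (hIw _ (hI ▸ Ideal.mul_mem_mul hy haQ))
      (Submodule.smul_mem_smul hy ((P.exact_zero _).1 ?_))
    rw [map_sub, hεw, ha, sub_self]
  -- A preimage can be chosen in 𝔪F_1, and the ambiguity lies in ker φ_1 = im φ_2 ≤ 𝔪F_1. Thus f, g
  -- ∈ 𝔪F_1 and x_0 f + x_1 g ∈ 𝔪²F_1.
  have hlift : ∀ h : P.F 1, P.φ 0 h ∈ maximalIdeal R • LinearMap.range (P.φ 0) →
      h ∈ maximalIdeal R • (⊤ : Submodule R (P.F 1)) := by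
    intro h hh
    rw [LinearMap.range_eq_map, ← Submodule.map_smul''] at hh
    obtain ⟨h', hh', he⟩ := hh
    rw [← sub_add_cancel h h']
    refine add_mem (P.minimal 1 ((P.exact_succ 0 _).1 ?_)) hh'
    rw [map_sub, he, sub_self]
  rw [hfg, pow_two, ← smul_eq_mul, Submodule.smul_assoc]
  refine add_mem (Submodule.smul_mem_smul h0 (hlift f ?_))
    (Submodule.smul_mem_smul h1 (hlift g ?_))
  · rw [hf]
    exact neg_mem (hsm _ h1)
  · rw [hg]
    exact hsm _ h0

end DimensionTwo

theorem mainTheorem9 {R : Type u} [CommRing R] [IsRegularLocalRing R]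
    (d : ℕ) (hd : ringKrullDim R = d) (hd_pos : 1 ≤ d)
    (I : Ideal R) (hI : I.IsPrimary) (hI_rad : I.radical = IsLocalRing.maximalIdeal R)
    (P : MinimalFreeResolution.{u, u, v} R (R ⧸ I)) :
    (IsBurchIdeal I → IsPowerOfOneParameter d (idealOfEntries (P.φ (d - 1)))) ∧
    ((∃ k : Subring R, IsField k) →
      I.colon (IsLocalRing.maximalIdeal R : Set R) ^ 2 ≠
        I * I.colon (IsLocalRing.maximalIdeal R : Set R) →
      IsPowerOfOneParameter d (idealOfEntries (P.φ (d - 1)))) ∧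
    (d = 2 → IsPowerOfOneParameter d (idealOfEntries (P.φ (d - 1))) → IsBurchIdeal I) := by
  obtain ⟨n, rfl⟩ : ∃ n, d = n + 1 := ⟨d - 1, by omega⟩
  rw [Nat.add_sub_cancel]
  refine ⟨fun h => ?_, fun _ h => ?_, fun h2 h => ?_⟩
  · rcases P.isPowerOfOneParameter_or_idealOfEntries_le hd hI.ne_top hI_rad with
      h' | ⟨m, rfl, x, hx, hJ⟩
    · exact h'
    · exact absurd h (P.not_isBurchIdeal hd hx hJ)
  · rcases P.isPowerOfOneParameter_or_idealOfEntries_le hd hI.ne_top hI_rad with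
      h' | ⟨m, rfl, x, hx, hJ⟩
    · exact h'
    · exact absurd (P.colon_sq_eq hd hx hJ) h
  · obtain rfl : n = 1 := by omega
    obtain ⟨x, hx, hJ⟩ := exists_not_le_sq_of_isPowerOfOneParameter_two h
    by_contra hB
    exact hJ (P.idealOfEntries_le_sq_of_not_isBurchIdeal hd hx hB)
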